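/- Let $S\supseteq\mathbb{R}$ be a set of individuals and let $*:\mathbb{V}(S)\to\mathbb{V}({}^*S)$ be a nonstandard extension of the superstructure over $S$, i.e. a map satisfying the extension principle (${}^*S$ is a proper extension of $S$ and ${}^*s=s$ for $s\in S$) and the transfer principle for formulas with bounded quantifiers. For $a,b\in{}^*\mathbb{R}$ write $a\approx b$ if $|a-b|<\varepsilon$ for every real $\varepsilon>0$, and let $\mathsf{st}(a)$ denote the real number infinitely close to a finite $a\in{}^*\mathbb{R}$. Let $X\in\mathbb{V}(S)$ be a metric space with Borel $\sigma$-algebra $\mathcal{B}(X)$, and let $\mathcal{M}(X)$ be the set of all charges on $X$, i.e. of finitely additive probability measures $P:\mathcal{B}(X)\to[0,1]$. The integral $\int f\,\mathrm{d}P$ of a function $f:X\to\mathbb{R}$ with respect to a charge $P$ is defined as $\lim_n\int f_n\,\mathrm{d}P$, where $(f_n)$ is any sequence of simple measurable functions that converges to $f$ in charge and satisfies $\int|f_n-f_m|\,\mathrm{d}P\to0$ as $m,n\to\infty$; $f$ is called integrable if such a sequence exists. An internal probability measure on $({}^*X,{}^*\mathcal{B}(X))$ is an element $\nu$ of ${}^*\mathcal{M}(X)$;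 its internal push-down is the function $\nu_{\mathrm{ip}}:\mathcal{B}(X)\to[0,1]$ given by $\nu_{\mathrm{ip}}(A)=\mathsf{st}(\nu({}^*A))$. The internal integral $\int_{{}^*X} F\,\mathrm{d}\nu$ is the value at $(F,\nu)$ of the nonstandard extension of the map $(f,P)\mapsto\int f\,\mathrm{d}P$ defined for bounded Borel functions $f$ and charges $P$. Theorem. Let $\nu$ be an internal probability measure on $({}^*X,{}^*\mathcal{B}(X))$ and let $f:X\to\mathbb{R}$ be a bounded Borel measurable function. Then $\nu_{\mathrm{ip}}$ is a charge on $(X,\mathcal{B}(X))$, $f$ is integrable with respect to $\nu_{\mathrm{ip}}$, and $$\int_{{}^*X}{}^*f(x)\,\nu(\mathrm{d}x)\;\approx\;\int_X f(x)\,\nu_{\mathrm{ip}}(\mathrm{d}x).$$ -/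

import Mathlib

open Filter Topology

universe u

/-! ## Superstructures and nonstandard extensions -/

/-- The `n`-th level of the superstructure over a set `S` of individuals
(counting from `0`): `V₀(S) = S` and `Vₙ₊₁(S) = Vₙ(S) ∪ 𝒫(Vₙ(S))`. -/
noncomputable def superLevel (S : ZFSet.{u}) : ℕ → ZFSet.{u}
  | 0 => S
  | n + 1 => superLevel S n ∪ ZFSet.powerset (superLevel S n)

/-- The superstructure `V(S) = ⋃ₙ Vₙ(S)`. -/
def Superstructure (S : ZFSet.{u}) : Set ZFSet.{u} :=
  {x | ∃ n, x ∈ superLevel S n}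

/-- `S` is a base set: its elements behave as individuals in `V(S)`, that is, they are
not the empty set and have no elements inside `V(S)`. -/
def IsBaseSet (S : ZFSet.{u}) : Prop :=
  ∀ s ∈ S, s ≠ ∅ ∧ ∀ x ∈ s, x ∉ Superstructure S

/-- Formulas built from `=` and `∈` with connectives and bounded quantifiers; the variables
are numbered. `ball i j φ` is `(∀ xᵢ ∈ xⱼ) φ` and `bex i j φ` is `(∃ xᵢ ∈ xⱼ) φ`. -/
inductive BddFormula : Type
  | eq (i j : ℕ) : BddFormula
  | mem (i j : ℕ) : BddFormula
  | neg (φ : BddFormula) : BddFormula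
  | conj (φ ψ : BddFormula) : BddFormula
  | disj (φ ψ : BddFormula) : BddFormula
  | ball (i j : ℕ) (φ : BddFormula) : BddFormula
  | bex (i j : ℕ) (φ : BddFormula) : BddFormula

/-- Truth of a formula in a universe `U` of sets and individuals under an assignment `v`
of the variables. -/
def BddFormula.Sat (U : Set ZFSet.{u}) : BddFormula → (ℕ → ZFSet.{u}) → Prop
  | .eq i j, v => v i = v j
  | .mem i j, v => v i ∈ v j
  | .neg φ, v => ¬ φ.Sat U v
  | .conj φ ψ, v => φ.Sat U v ∧ ψ.Sat U v
  | .disj φ ψ, v => φ.Sat U v ∨ ψ.Sat U v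
  | .ball i j φ, v => ∀ x ∈ U, x ∈ v j → φ.Sat U (Function.update v i x)
  | .bex i j φ, v => ∃ x ∈ U, x ∈ v j ∧ φ.Sat U (Function.update v i x)

/-- A nonstandard extension `* : V(S) → V(*S)` of the superstructure over a set `S` of
individuals that contains the reals, subject to the extension and the transfer principles.
(The values of `nse` outside `V(S)` are irrelevant.) -/
structure NonstandardExtension where
  /-- the set `S` of standard individuals -/
  S : ZFSet.{u}
  isBaseSet : IsBaseSet S
  /-- the inclusion of the real numbers in `S` -/
  real : ℝ → ZFSet.{u}
  real_injective : Function.Injective real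
  real_mem : ∀ t, real t ∈ S
  /-- the map `x ↦ *x` -/
  nse : ZFSet.{u} → ZFSet.{u}
  isBaseSet_nse : IsBaseSet (nse S)
  nse_mem : ∀ x ∈ Superstructure S, nse x ∈ Superstructure (nse S)
  /-- extension principle: `*S` is a proper extension of `S` and `*s = s` for `s ∈ S` -/
  subset_nse : S ⊆ nse S
  ne_nse : S ≠ nse S
  nse_individual : ∀ s ∈ S, nse s = s
  /-- transfer principle -/
  transfer : ∀ (φ : BddFormula) (v : ℕ → ZFSet.{u}), (∀ i, v i ∈ Superstructure S) →
    φ.Sat (Superstructure S) v → φ.Sat (Superstructure (nse S)) (fun i => nse (v i))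

/-- The elements of a set, as a type. -/
abbrev ZFSet.El (X : ZFSet.{u}) : Type (u + 1) := {x : ZFSet.{u} // x ∈ X}

/-! ## Charges and integration with respect to charges -/

section Charge

variable {α : Type*} [MeasurableSpace α]

/-- The σ-algebra of a measurable space, as a type. -/
abbrev MSet (α : Type*) [MeasurableSpace α] : Type _ := {A : Set α // MeasurableSet A}

/-- A charge: a finitely additive probability measure. -/
structure IsCharge (P : MSet α → ℝ) : Prop where
  mem_Icc : ∀ A, P A ∈ Set.Icc (0 : ℝ) 1
  empty : P ⟨∅, MeasurableSet.empty⟩ = 0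
  univ : P ⟨Set.univ, MeasurableSet.univ⟩ = 1
  union : ∀ A B : MSet α, A.1 ∩ B.1 = ∅ → P ⟨A.1 ∪ B.1, A.2.union B.2⟩ = P A + P B

/-- The integral `∑ y, y P(g = y)` of a simple function. -/
noncomputable def simpleIntegral (P : MSet α → ℝ) (g : MeasureTheory.SimpleFunc α ℝ) : ℝ :=
  ∑ y ∈ g.range, y * P ⟨g ⁻¹' {y}, g.measurableSet_fiber y⟩

/-- `r` is the integral of `f` with respect to `P`: there is a sequence of simple functions
which converges to `f` hazily (in charge), which is Cauchy in mean, and whose integrals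
converge to `r`. -/
def HasChargeIntegral (P : MSet α → ℝ) (f : α → ℝ) (r : ℝ) : Prop :=
  ∃ g : ℕ → MeasureTheory.SimpleFunc α ℝ,
    (∀ ε > 0, ∀ δ > 0, ∃ N, ∀ n ≥ N, ∃ A : MSet α, {x | ε < |g n x - f x|} ⊆ A.1 ∧ P A < δ) ∧
    (∀ ε > 0, ∃ N, ∀ m ≥ N, ∀ n ≥ N,
      simpleIntegral P ((g m - g n).map fun t => |t|) < ε) ∧
    Tendsto (fun n => simpleIntegral P (g n)) atTop (𝓝 r)

/-- `f` is integrable with respect to `P`. -/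
def ChargeIntegrable (P : MSet α → ℝ) (f : α → ℝ) : Prop :=
  ∃ r, HasChargeIntegral P f r

open Classical in
/-- The integral of `f` with respect to `P` (zero if `f` is not integrable). -/
noncomputable def chargeIntegral (P : MSet α → ℝ) (f : α → ℝ) : ℝ :=
  if h : ChargeIntegrable P f then h.choose else 0

end Charge

open Classical in
/-- The value at `a` of a function given as a set `F` of ordered pairs
(the empty set if there is none). -/
noncomputable def ZFSet.app (F a : ZFSet.{u}) : ZFSet.{u} :=
  if h : ∃ b, ZFSet.pair a b ∈ F then h.choose else ∅

namespace NonstandardExtension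

variable (M : NonstandardExtension.{u})

/-! ## The hyperreals -/

/-- The set of pairs of reals which are less than `ε` apart. -/
noncomputable def closeRel (ε : ℝ) : ZFSet.{u} :=
  ZFSet.range fun p : {p : ℝ × ℝ // |p.1 - p.2| < ε} => ZFSet.pair (M.real p.1.1) (M.real p.1.2)

/-- `a ≈ b` for hyperreals: `|a - b| < ε` for every standard `ε > 0`. -/
def Near (a b : ZFSet.{u}) : Prop :=
  ∀ ε : ℝ, 0 < ε → ZFSet.pair a b ∈ M.nse (M.closeRel ε)

open Classical in
/-- The standard part of a hyperreal (zero if there is none). -/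
noncomputable def st (a : ZFSet.{u}) : ℝ :=
  if h : ∃ t : ℝ, M.Near a (M.real t) then h.choose else 0

/-! ## Standard objects over a measurable space as elements of the superstructure -/

variable {X : ZFSet.{u}}

/-- A subset of `X` as an element of the superstructure. -/
def setCode (A : Set X.El) : ZFSet.{u} :=
  ZFSet.sep (fun x => ∃ h : x ∈ X, (⟨x, h⟩ : X.El) ∈ A) X

/-- A real function on `X` as an element of the superstructure: its graph. -/
noncomputable def funCode (f : X.El → ℝ) : ZFSet.{u} :=
  ZFSet.range fun x : X.El => ZFSet.pair x.1 (M.real (f x))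

variable [MeasurableSpace X.El]

/-- A real function on the σ-algebra of `X` as an element of the superstructure: its graph. -/
noncomputable def chargeCode (P : MSet X.El → ℝ) : ZFSet.{u} :=
  ZFSet.range fun A : MSet X.El => ZFSet.pair (setCode A.1) (M.real (P A))

variable (X) in
/-- The set of all charges on `X`. -/
noncomputable def charges : ZFSet.{u} :=
  ZFSet.range fun P : {P : MSet X.El → ℝ // IsCharge P} => M.chargeCode P.1

variable (X) in
/-- The map `(f, P) ↦ ∫ f dP` for bounded measurable `f` and charges `P`, as a set of
ordered pairs. -/
noncomputable def integralCode : ZFSet.{u} :=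
  ZFSet.range fun q : {f : X.El → ℝ // Measurable f ∧ ∃ C, ∀ x, |f x| ≤ C} ×
      {P : MSet X.El → ℝ // IsCharge P} =>
    ZFSet.pair (ZFSet.pair (M.funCode q.1.1) (M.chargeCode q.2.1))
      (M.real (chargeIntegral q.2.1 q.1.1))

/-! ## Internal probability measures -/

variable (X) in
/-- Internal probability measures: the elements of the nonstandard extension of the set of
all charges on `X`. -/
def IsInternalProbability (ν : ZFSet.{u}) : Prop := ν ∈ M.nse (M.charges X)

variable (X) in
/-- The internal integral `∫ F dν`: the value at `(F, ν)` of the nonstandard extension of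
the map `(f, P) ↦ ∫ f dP`. -/
noncomputable def internalIntegral (F ν : ZFSet.{u}) : ZFSet.{u} :=
  (M.nse (M.integralCode X)).app (ZFSet.pair F ν)

/-- The internal push-down `A ↦ st (ν(*A))`. -/
noncomputable def pushDown (ν : ZFSet.{u}) (A : MSet X.El) : ℝ :=
  M.st (ν.app (M.nse (setCode A.1)))

end NonstandardExtension

/-! The internal measure `ν` is replaced by an ultrafilter on the set of standard charges: the sets
`E` of charges with `ν ∈ *E` form an ultrafilter `U`, because transfer preserves inclusions, unions
and disjointness.

For a standard set `A` and a real `t`, put `E = {P | |P(A) - t| < ε}`. Transferring "`P ∈ E` iff the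
value of `P` at `A` is within `ε` of `t`" from all charges to `ν` shows that `ν(*A) ≈ t` exactly
when `P(A) → t` along `U` (`near_app_iff`). The same argument for the map `(f, P) ↦ ∫ f dP` shows
that the internal integral of `*f` is near `t` exactly when `∫ f dP → t` along `U`
(`near_internalIntegral_iff`). As `[0,1]` is compact, the limits of `P(A)` exist, so the push-down
is the setwise limit of the standard charges along `U` (`tendsto_pushDown`).

What remains is standard: a setwise limit of charges is a charge (`IsCharge.of_tendsto`), and
integrals of a bounded measurable function converge along with the charges
(`tendsto_chargeIntegral`), since the function is a uniform limit of simple functions and every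
charge has total mass one. No arithmetic of hyperreals is needed. -/

/-! ## Integration with respect to charges -/

section ChargeLemmas

open MeasureTheory

variable {α : Type*} [MeasurableSpace α] {P : MSet α → ℝ}

open Classical in
/-- A set function as an operator-valued function on all subsets (zero off the σ-algebra). -/
noncomputable def chargeOp (P : MSet α → ℝ) (s : Set α) : ℝ →L[ℝ] ℝ :=
  if h : MeasurableSet s then P ⟨s, h⟩ • ContinuousLinearMap.id ℝ ℝ else 0

theorem chargeOp_apply (P : MSet α → ℝ) {s : Set α} (h : MeasurableSet s) (y : ℝ) :
    chargeOp P s y = P ⟨s, h⟩ * y := by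
  simp [chargeOp, h]

theorem simpleIntegral_eq_setToSimpleFunc (P : MSet α → ℝ) (g : SimpleFunc α ℝ) :
    simpleIntegral P g = g.setToSimpleFunc (chargeOp P) := by
  unfold simpleIntegral SimpleFunc.setToSimpleFunc
  refine Finset.sum_congr rfl fun y _ => ?_
  rw [chargeOp_apply P (g.measurableSet_fiber y), mul_comm]

namespace IsCharge

theorem chargeOp_empty (hP : IsCharge P) : chargeOp P ∅ = 0 := by
  ext
  rw [chargeOp_apply P MeasurableSet.empty, hP.empty]
  simp

/-- The zero measure serves as reference: every set has finite measure and every function is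
integrable, so the side conditions of the `setToSimpleFunc` lemmas are trivial and linearity and
monotonicity follow from finite additivity alone. -/
theorem finMeasAdditive_chargeOp (hP : IsCharge P) :
    FinMeasAdditive (0 : Measure α) (chargeOp P) := by
  intro s t hs ht _ _ hst
  ext
  rw [chargeOp_apply P (hs.union ht), add_apply, chargeOp_apply P hs,
    chargeOp_apply P ht, hP.union ⟨s, hs⟩ ⟨t, ht⟩ (Set.disjoint_iff_inter_eq_empty.1 hst)]
  ring

theorem simpleIntegral_add (hP : IsCharge P) (g h : SimpleFunc α ℝ) :
    simpleIntegral P (g + h) = simpleIntegral P g + simpleIntegral P h := by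
  simp only [simpleIntegral_eq_setToSimpleFunc]
  exact SimpleFunc.setToSimpleFunc_add _ hP.finMeasAdditive_chargeOp
    integrable_zero_measure integrable_zero_measure

theorem simpleIntegral_sub (hP : IsCharge P) (g h : SimpleFunc α ℝ) :
    simpleIntegral P (g - h) = simpleIntegral P g - simpleIntegral P h := by
  simp only [simpleIntegral_eq_setToSimpleFunc]
  exact SimpleFunc.setToSimpleFunc_sub _ hP.finMeasAdditive_chargeOp
    integrable_zero_measure integrable_zero_measure

theorem simpleIntegral_mono (hP : IsCharge P) {g h : SimpleFunc α ℝ} (hgh : ∀ x, g x ≤ h x) :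
    simpleIntegral P g ≤ simpleIntegral P h := by
  simp only [simpleIntegral_eq_setToSimpleFunc]
  refine SimpleFunc.setToSimpleFunc_mono hP.finMeasAdditive_chargeOp (fun s hs _ x hx => ?_)
    integrable_zero_measure integrable_zero_measure hgh
  rw [chargeOp_apply P hs]
  exact mul_nonneg (hP.mem_Icc _).1 hx

theorem simpleIntegral_const (hP : IsCharge P) (c : ℝ) :
    simpleIntegral P (SimpleFunc.const α c) = c := by
  rw [simpleIntegral_eq_setToSimpleFunc, SimpleFunc.setToSimpleFunc_const _ hP.chargeOp_empty,
    chargeOp_apply P MeasurableSet.univ, hP.univ, one_mul]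

theorem simpleIntegral_piecewise (hP : IsCharge P) (A : MSet α) (c : ℝ) :
    simpleIntegral P (SimpleFunc.piecewise A.1 A.2 (SimpleFunc.const α c) (SimpleFunc.const α 0))
      = P A * c := by
  rw [simpleIntegral_eq_setToSimpleFunc,
    SimpleFunc.setToSimpleFunc_indicator _ hP.chargeOp_empty, chargeOp_apply P A.2]

/-- A simple function bounded by `c` off `A` and by `c + d` on `A` has integral at most
`c + d P(A)`. -/
theorem simpleIntegral_le (hP : IsCharge P) {g : SimpleFunc α ℝ} (A : MSet α) {c d : ℝ}
    (hc : ∀ x ∉ A.1, g x ≤ c) (hd : ∀ x ∈ A.1, g x ≤ c + d) :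
    simpleIntegral P g ≤ c + P A * d := by
  rw [← hP.simpleIntegral_piecewise A d]
  nth_rewrite 1 [← hP.simpleIntegral_const c]
  rw [← hP.simpleIntegral_add]
  refine hP.simpleIntegral_mono fun x => ?_
  by_cases hx : x ∈ A.1
  · simpa [hx] using hd x hx
  · simpa [hx] using hc x hx

theorem simpleIntegral_le_of_le (hP : IsCharge P) {g : SimpleFunc α ℝ} {c : ℝ}
    (hc : ∀ x, g x ≤ c) : simpleIntegral P g ≤ c := by
  simpa using hP.simpleIntegral_le (d := 0) ⟨∅, MeasurableSet.empty⟩ (fun x _ => hc x)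
    (fun x _ => by simpa using hc x)

theorem abs_simpleIntegral_sub_le (hP : IsCharge P) (g h : SimpleFunc α ℝ) :
    |simpleIntegral P g - simpleIntegral P h| ≤
      simpleIntegral P ((g - h).map fun t => |t|) := by
  have key : ∀ g h : SimpleFunc α ℝ, simpleIntegral P g - simpleIntegral P h ≤
      simpleIntegral P ((g - h).map fun t => |t|) := fun g h => by
    rw [← hP.simpleIntegral_sub]
    exact hP.simpleIntegral_mono fun x => le_abs_self _
  refine abs_le'.2 ⟨key g h, ?_⟩
  rw [neg_sub]
  refine (key h g).trans (le_of_eq ?_)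
  congr 1
  ext x
  exact abs_sub_comm _ _

end IsCharge

/-- The integral of a function uniformly within `ε` of a simple function is within `ε` of the
integral of the simple function. -/
theorem HasChargeIntegral.abs_sub_simpleIntegral_le (hP : IsCharge P) {f : α → ℝ} {r : ℝ}
    (hr : HasChargeIntegral P f r) (g : SimpleFunc α ℝ) {ε : ℝ} (hg : ∀ x, |f x - g x| ≤ ε) :
    |r - simpleIntegral P g| ≤ ε := by
  obtain ⟨s, hazy, cauchy, lim⟩ := hr
  refine le_of_forall_pos_le_add fun η hη => ?_
  have hη3 : 0 < η / 3 := by positivity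
  obtain ⟨N, hN⟩ := cauchy _ hη3
  obtain ⟨C, hC⟩ := (s N - g).exists_forall_norm_le
  have hC' : ∀ x, |s N x - g x| ≤ C := hC
  have hC1 : 0 < |C| + 1 := by positivity
  -- The tolerance makes `P A * (|C| + 1) ≤ η / 3`, where `C` bounds `|s N - g|`.
  obtain ⟨N', hN'⟩ := hazy _ hη3 (η / 3 / (|C| + 1)) (by positivity)
  refine le_of_tendsto ((lim.sub_const _).abs) ?_
  filter_upwards [eventually_ge_atTop N, eventually_ge_atTop N'] with n hn hn'
  obtain ⟨A, hA, hPA⟩ := hN' n hn'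
  refine (hP.abs_simpleIntegral_sub_le _ _).trans ?_
  -- The `s n` need not be uniformly bounded, so `|s n - g|` cannot be estimated directly on the
  -- exceptional set `A`. After subtracting `|s n - s N|`, whose integral is small, at most `|s N -
  -- g|` is left there, a bound independent of `n`.
  have h1 : simpleIntegral P ((s n - g).map fun t => |t|) ≤
      simpleIntegral P ((s n - s N).map fun t => |t|) +
      simpleIntegral P ((s n - g).map (fun t => |t|) - (s n - s N).map fun t => |t|) := by
    rw [hP.simpleIntegral_sub]; linarith
  have h2 : simpleIntegral P ((s n - g).map (fun t => |t|) - (s n - s N).map fun t => |t|) ≤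
      (ε + η / 3) + P A * (|C| + 1) := by
    refine hP.simpleIntegral_le A (fun x hx => ?_) (fun x hx => ?_)
    · have hx' : ¬ η / 3 < |s n x - f x| := fun h => hx (hA h)
      have h3 : |s n x - g x| ≤ |s n x - f x| + |f x - g x| := abs_sub_le _ _ _
      have h4 := abs_nonneg (s n x - s N x)
      have h5 := hg x
      simp only [SimpleFunc.coe_sub, Pi.sub_apply, SimpleFunc.map_apply]
      linarith
    · have h3 : |s n x - g x| ≤ |s n x - s N x| + |s N x - g x| := abs_sub_le _ _ _
      have h4 := (abs_nonneg _).trans (hg x)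
      have h5 := hC' x
      have h6 := le_abs_self C
      simp only [SimpleFunc.coe_sub, Pi.sub_apply, SimpleFunc.map_apply]
      linarith
  have h3 : P A * (|C| + 1) ≤ η / 3 := by
    rw [lt_div_iff₀ hC1] at hPA
    exact hPA.le
  have h4 := hN n hn N le_rfl
  linarith

/-- Bounded measurable functions are uniform limits of simple functions. -/
theorem exists_simpleFunc_abs_sub_le {f : α → ℝ} (hf : Measurable f) (hb : ∃ C, ∀ x, |f x| ≤ C)
    {ε : ℝ} (hε : 0 < ε) : ∃ g : SimpleFunc α ℝ, ∀ x, |f x - g x| ≤ ε := by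
  obtain ⟨C, hC⟩ := hb
  -- Round `f` down to a multiple of `ε`; boundedness leaves finitely many values.
  have hm : Measurable fun x => (⌊f x / ε⌋ : ℝ) * ε := by fun_prop
  refine ⟨⟨fun x => (⌊f x / ε⌋ : ℝ) * ε, fun y => hm (measurableSet_singleton y), ?_⟩, fun x => ?_⟩
  · refine ((Set.finite_Icc ⌊-C / ε⌋ ⌊C / ε⌋).image fun k : ℤ => (k : ℝ) * ε).subset ?_
    rintro _ ⟨x, rfl⟩
    obtain ⟨h1, h2⟩ := abs_le.1 (hC x)
    exact ⟨⌊f x / ε⌋, ⟨Int.floor_le_floor (by gcongr), Int.floor_le_floor (by gcongr)⟩, rfl⟩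
  · change |f x - (⌊f x / ε⌋ : ℝ) * ε| ≤ ε
    have h1 : (⌊f x / ε⌋ : ℝ) * ε ≤ f x := (le_div_iff₀ hε).1 (Int.floor_le _)
    have h2 : f x < ((⌊f x / ε⌋ : ℝ) + 1) * ε := (div_lt_iff₀ hε).1 (Int.lt_floor_add_one _)
    rw [abs_of_nonneg (by linarith)]
    linarith

/-- Uniform approximation within `1 / (n + 1)` converges in charge with empty exceptional set, and
total mass one makes it Cauchy in mean. -/
theorem IsCharge.chargeIntegrable (hP : IsCharge P) {f : α → ℝ} (hf : Measurable f)
    (hb : ∃ C, ∀ x, |f x| ≤ C) : ChargeIntegrable P f := by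
  choose g hg using fun n : ℕ =>
    exists_simpleFunc_abs_sub_le hf hb (Nat.one_div_pos_of_nat (α := ℝ) (n := n))
  have hsmall : ∀ ε : ℝ, 0 < ε → ∃ N : ℕ, ∀ n ≥ N, 1 / ((n : ℝ) + 1) < ε := fun ε hε => by
    obtain ⟨N, hN⟩ := exists_nat_one_div_lt hε
    exact ⟨N, fun n hn => (Nat.one_div_le_one_div hn).trans_lt hN⟩
  have hcauchy : ∀ ε > 0, ∃ N, ∀ m ≥ N, ∀ n ≥ N,
      simpleIntegral P ((g m - g n).map fun t => |t|) < ε := fun ε hε => by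
    obtain ⟨N, hN⟩ := hsmall (ε / 2) (by positivity)
    refine ⟨N, fun m hm n hn => ?_⟩
    refine lt_of_le_of_lt (hP.simpleIntegral_le_of_le
      (c := 1 / ((m : ℝ) + 1) + 1 / ((n : ℝ) + 1)) fun x => ?_)
      (by linarith [hN m hm, hN n hn])
    have h1 : |g m x - g n x| ≤ |g m x - f x| + |f x - g n x| := abs_sub_le _ _ _
    have h2 := hg m x
    have h3 := hg n x
    rw [abs_sub_comm] at h2
    simp only [SimpleFunc.coe_sub, Pi.sub_apply, SimpleFunc.map_apply]
    linarith
  obtain ⟨r, hr⟩ := cauchySeq_tendsto_of_complete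
    (u := fun n => simpleIntegral P (g n)) (Metric.cauchySeq_iff.2 fun ε hε => by
      obtain ⟨N, hN⟩ := hcauchy ε hε
      exact ⟨N, fun m hm n hn => (hP.abs_simpleIntegral_sub_le _ _).trans_lt (hN m hm n hn)⟩)
  refine ⟨r, g, fun ε hε δ hδ => ?_, hcauchy, hr⟩
  obtain ⟨N, hN⟩ := hsmall ε hε
  refine ⟨N, fun n hn => ⟨⟨∅, MeasurableSet.empty⟩, fun x hx => ?_, by rwa [hP.empty]⟩⟩
  have h1 : ε < |g n x - f x| := hx
  have h2 := hg n x
  rw [abs_sub_comm] at h2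
  linarith [hN n hn]

/-- The estimate holds for every admissible value of the integral, hence for the chosen one;
uniqueness of the integral is not needed separately. -/
theorem IsCharge.abs_chargeIntegral_sub_le (hP : IsCharge P) {f : α → ℝ} (hf : Measurable f)
    (hb : ∃ C, ∀ x, |f x| ≤ C) (g : SimpleFunc α ℝ) {ε : ℝ} (hg : ∀ x, |f x - g x| ≤ ε) :
    |chargeIntegral P f - simpleIntegral P g| ≤ ε := by
  have h := hP.chargeIntegrable hf hb
  rw [chargeIntegral, dif_pos h]
  exact h.choose_spec.abs_sub_simpleIntegral_le hP g hg

/-! ### Limits of charges -/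

variable {ι : Type*} {l : Filter ι} {Q : ι → MSet α → ℝ}

/-- Each axiom is a closed condition on finitely many values, so it survives pointwise limits. -/
theorem IsCharge.of_tendsto [l.NeBot] (hQ : ∀ i, IsCharge (Q i))
    (h : ∀ A, Tendsto (fun i => Q i A) l (𝓝 (P A))) : IsCharge P where
  mem_Icc A := isClosed_Icc.mem_of_tendsto (h A) (Eventually.of_forall fun i => (hQ i).mem_Icc A)
  empty := tendsto_nhds_unique (h _) (by simp only [(hQ _).empty, tendsto_const_nhds])
  univ := tendsto_nhds_unique (h _) (by simp only [(hQ _).univ, tendsto_const_nhds])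
  union A B hAB := tendsto_nhds_unique (h _)
    (by simpa only [(hQ _).union A B hAB] using (h A).add (h B))

/-- The integral of a simple function is a finite sum of set values and so converges; replacing `f`
by it costs at most `ε / 3`, uniformly over all charges. -/
theorem tendsto_chargeIntegral (hQ : ∀ i, IsCharge (Q i)) (hP : IsCharge P)
    (h : ∀ A, Tendsto (fun i => Q i A) l (𝓝 (P A))) {f : α → ℝ} (hf : Measurable f)
    (hb : ∃ C, ∀ x, |f x| ≤ C) :
    Tendsto (fun i => chargeIntegral (Q i) f) l (𝓝 (chargeIntegral P f)) := by
  rw [Metric.tendsto_nhds]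
  intro ε hε
  obtain ⟨g, hg⟩ := exists_simpleFunc_abs_sub_le hf hb (ε := ε / 3) (by positivity)
  have hlim : Tendsto (fun i => simpleIntegral (Q i) g) l (𝓝 (simpleIntegral P g)) :=
    tendsto_finsetSum _ fun y _ => (h _).const_mul y
  filter_upwards [Metric.tendsto_nhds.1 hlim (ε / 3) (by positivity)] with i hi
  rw [Real.dist_eq] at hi ⊢
  have h1 := abs_le.1 ((hQ i).abs_chargeIntegral_sub_le hf hb g hg)
  have h2 := abs_le.1 (hP.abs_chargeIntegral_sub_le hf hb g hg)
  rw [abs_lt] at hi ⊢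
  constructor <;> linarith

end ChargeLemmas

/-! ## Superstructures -/

section Superstructure

variable {S x y a b : ZFSet.{u}} {m n : ℕ}

theorem superLevel_mono (S : ZFSet.{u}) (h : m ≤ n) : superLevel S m ⊆ superLevel S n := by
  induction n, h using Nat.le_induction with
  | base => exact fun _ h => h
  | succ n _ ih => exact fun x hx => ZFSet.mem_union.2 (Or.inl (ih hx))

theorem mem_superLevel_succ (h : x ⊆ superLevel S n) : x ∈ superLevel S (n + 1) :=
  ZFSet.mem_union.2 (Or.inr (ZFSet.mem_powerset.2 h))

theorem exists_subset_superLevel (hx : x ∈ Superstructure S) (hxS : x ∉ S) :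
    ∃ n, x ⊆ superLevel S n := by
  obtain ⟨n, hn⟩ := hx
  induction n with
  | zero => exact absurd hn hxS
  | succ n ih =>
    rcases ZFSet.mem_union.1 hn with h | h
    · exact ih h
    · exact ⟨n, ZFSet.mem_powerset.1 h⟩

theorem Superstructure.of_mem (hx : x ∈ Superstructure S) (hxS : x ∉ S) (hy : y ∈ x) :
    y ∈ Superstructure S :=
  let ⟨n, hn⟩ := exists_subset_superLevel hx hxS
  ⟨n, hn hy⟩

/-- Individuals are themselves `ZFSet`s and may have elements, but none in the superstructure. One
element there thus certifies a genuine set, to which `Superstructure.of_mem` applies. -/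
theorem IsBaseSet.notMem_of_mem (hS : IsBaseSet S) (hy : y ∈ Superstructure S) (hyx : y ∈ x) :
    x ∉ S :=
  fun hx => (hS x hx).2 y hyx hy

/-! ### Ordered pairs in the superstructure -/

theorem pair_mem_superLevel (ha : a ∈ superLevel S n) (hb : b ∈ superLevel S n) :
    ZFSet.pair a b ∈ superLevel S (n + 2) := by
  refine mem_superLevel_succ fun z hz => ?_
  rcases ZFSet.mem_pair.1 hz with rfl | rfl <;> refine mem_superLevel_succ fun w hw => ?_
  · rwa [ZFSet.mem_singleton.1 hw]
  · rcases ZFSet.mem_pair.1 hw with rfl | rfl <;> assumption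

theorem singleton_mem_superstructure (ha : a ∈ Superstructure S) :
    ({a} : ZFSet) ∈ Superstructure S := by
  obtain ⟨n, hn⟩ := ha
  exact ⟨n + 1, mem_superLevel_succ fun w hw => by rwa [ZFSet.mem_singleton.1 hw]⟩

theorem singleton_mem_pair (a b : ZFSet.{u}) : ({a} : ZFSet) ∈ ZFSet.pair a b :=
  ZFSet.mem_pair.2 (Or.inl rfl)

theorem upair_mem_pair (a b : ZFSet.{u}) : ({a, b} : ZFSet) ∈ ZFSet.pair a b :=
  ZFSet.mem_pair.2 (Or.inr rfl)

theorem upair_mem_of_pair_mem (hS : IsBaseSet S) (h : ZFSet.pair a b ∈ Superstructure S)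
    (ha : a ∈ Superstructure S) : ({a, b} : ZFSet) ∈ Superstructure S :=
  .of_mem h (hS.notMem_of_mem (singleton_mem_superstructure ha) (singleton_mem_pair a b))
    (upair_mem_pair a b)

theorem mem_of_pair_mem (hS : IsBaseSet S) (h : ZFSet.pair a b ∈ Superstructure S)
    (ha : a ∈ Superstructure S) : b ∈ Superstructure S :=
  .of_mem (upair_mem_of_pair_mem hS h ha) (hS.notMem_of_mem ha (by simp)) (by simp)

/-- `p` is the ordered pair of `a` and `b`, with all quantifiers bounded and relative to `U`. -/
def IsPairIn (U : Set ZFSet.{u}) (p a b : ZFSet.{u}) : Prop :=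
  ∃ c ∈ U, c ∈ p ∧ ∃ d ∈ U, d ∈ p ∧ (∀ x ∈ U, x ∈ p → x = c ∨ x = d) ∧
    (a ∈ c ∧ ∀ x ∈ U, x ∈ c → x = a) ∧ (a ∈ d ∧ b ∈ d ∧ ∀ x ∈ U, x ∈ d → x = a ∨ x = b)

/-- The quantifiers relative to the superstructure see all elements of `p`, `c` and `d`, because
each of these contains an element of it and so is not an individual. -/
theorem isPairIn_iff (hS : IsBaseSet S) {p : ZFSet.{u}} (hp : p ∈ Superstructure S)
    (ha : a ∈ Superstructure S) (hb : b ∈ Superstructure S) :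
    IsPairIn (Superstructure S) p a b ↔ p = ZFSet.pair a b := by
  constructor
  · rintro ⟨c, hc, hcp, d, hd, hdp, hp', ⟨hac, hc'⟩, had, hbd, hd'⟩
    have hpS := hS.notMem_of_mem hc hcp
    have hcS := hS.notMem_of_mem ha hac
    have hdS := hS.notMem_of_mem ha had
    have hc1 : c = {a} := by
      ext x
      rw [ZFSet.mem_singleton]
      exact ⟨fun h => hc' x (.of_mem hc hcS h) h, fun h => h ▸ hac⟩
    have hd1 : d = {a, b} := by
      ext x
      rw [ZFSet.mem_pair]
      exact ⟨fun h => hd' x (.of_mem hd hdS h) h, by rintro (rfl | rfl) <;> assumption⟩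
    ext x
    rw [ZFSet.pair, ← hc1, ← hd1, ZFSet.mem_pair]
    exact ⟨fun h => hp' x (.of_mem hp hpS h) h, by rintro (rfl | rfl) <;> assumption⟩
  · rintro rfl
    exact ⟨{a}, singleton_mem_superstructure ha, singleton_mem_pair a b, {a, b},
      upair_mem_of_pair_mem hS hp ha, upair_mem_pair a b, fun x _ hx => ZFSet.mem_pair.1 hx,
      ⟨by simp, by simp⟩, by simp, by simp, by simp⟩

theorem exists_isPairIn_iff (hS : IsBaseSet S) {r : ZFSet.{u}} (hr : r ∈ Superstructure S)
    (hrS : r ∉ S) (ha : a ∈ Superstructure S) (hb : b ∈ Superstructure S) :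
    (∃ q ∈ Superstructure S, q ∈ r ∧ IsPairIn (Superstructure S) q a b) ↔ ZFSet.pair a b ∈ r := by
  constructor
  · rintro ⟨q, hq, hqr, h⟩
    rwa [← (isPairIn_iff hS hq ha hb).1 h]
  · exact fun h => ⟨_, .of_mem hr hrS h, h, (isPairIn_iff hS (.of_mem hr hrS h) ha hb).2 rfl⟩

/-- The formula saying that the variable `i` is the ordered pair of `j` and `k`; the variables
`100`, `101` and `102` are used internally. -/
def BddFormula.isPair (i j k : ℕ) : BddFormula :=
  .bex 100 i (.bex 101 i (.conj (.ball 102 i (.disj (.eq 102 100) (.eq 102 101)))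
    (.conj (.conj (.mem j 100) (.ball 102 100 (.eq 102 j)))
      (.conj (.mem j 101) (.conj (.mem k 101)
        (.ball 102 101 (.disj (.eq 102 j) (.eq 102 k))))))))

/-- The bounds on the indices prevent capture by the internal variables. -/
theorem BddFormula.sat_isPair (U : Set ZFSet.{u}) {i j k : ℕ} (hi : i < 100) (hj : j < 100)
    (hk : k < 100) (v : ℕ → ZFSet.{u}) :
    (BddFormula.isPair i j k).Sat U v ↔ IsPairIn U (v i) (v j) (v k) := by
  have h1 : i ≠ 100 := by omega
  have h2 : i ≠ 101 := by omega
  have h3 : j ≠ 100 := by omega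
  have h4 : j ≠ 101 := by omega
  have h5 : j ≠ 102 := by omega
  have h6 : k ≠ 100 := by omega
  have h7 : k ≠ 101 := by omega
  have h8 : k ≠ 102 := by omega
  simp [BddFormula.isPair, BddFormula.Sat, IsPairIn, *]

end Superstructure

namespace NonstandardExtension

variable (M : NonstandardExtension.{u})

/-! ## Standard sets and their codes -/

/-- `a` is a set of the superstructure over `S` (and not an individual). -/
def IsStdSet (a : ZFSet.{u}) : Prop := a ∈ Superstructure M.S ∧ a ∉ M.S

variable {M}

theorem nse_notMem {a : ZFSet.{u}} (ha : M.IsStdSet a) : M.nse a ∉ M.nse M.S := by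
  have hS : M.S ∈ Superstructure M.S := ⟨1, mem_superLevel_succ fun _ h => h⟩
  have := M.transfer (.neg (.mem 0 1)) (fun i => if i = 0 then a else M.S)
    (fun i => by split_ifs <;> [exact ha.1; exact hS])
    (by simpa [BddFormula.Sat] using ha.2)
  simpa [BddFormula.Sat] using this

theorem mem_superstructure_of_mem_nse {a x : ZFSet.{u}} (ha : M.IsStdSet a) (hx : x ∈ M.nse a) :
    x ∈ Superstructure (M.nse M.S) :=
  .of_mem (M.nse_mem a ha.1) (nse_notMem ha) hx

theorem isStdSet_of_subset {a : ZFSet.{u}} {n : ℕ} (h : a ⊆ superLevel M.S n) :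
    M.IsStdSet a := by
  refine ⟨⟨n + 1, mem_superLevel_succ h⟩, fun ha => ?_⟩
  obtain ⟨h0, h1⟩ := M.isBaseSet a ha
  obtain ⟨x, hx⟩ := (ZFSet.eq_empty_or_nonempty a).resolve_left h0
  exact h1 x hx ⟨n, h hx⟩

/-- Transfer with a list of parameters. -/
theorem transfer_list (φ : BddFormula) (l : List ZFSet.{u})
    (hl : ∀ a ∈ l, a ∈ Superstructure M.S)
    (h : φ.Sat (Superstructure M.S) fun i => l.getD i M.S) :
    φ.Sat (Superstructure (M.nse M.S)) fun i => M.nse (l.getD i M.S) := by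
  -- Variables beyond the list hold `M.S`, since transfer requires every variable to lie in the
  -- superstructure.
  refine M.transfer φ _ (fun i => ?_) h
  rcases lt_or_ge i l.length with hi | hi
  · rw [List.getD_eq_getElem _ _ hi]
    exact hl _ (List.getElem_mem hi)
  · rw [List.getD_eq_default _ _ hi]
    exact ⟨1, mem_superLevel_succ fun _ h => h⟩

theorem real_mem_superLevel (n : ℕ) (t : ℝ) : M.real t ∈ superLevel M.S n :=
  superLevel_mono M.S (Nat.zero_le n) (M.real_mem t)

theorem nse_real (t : ℝ) : M.nse (M.real t) = M.real t :=
  M.nse_individual _ (M.real_mem t)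

section Sets

variable {a b c x : ZFSet.{u}}

/-- This form yields two filter axioms at once: upward closure with `b = a`, and closure under
intersection. -/
theorem nse_inter_subset (ha : M.IsStdSet a) (hb : b ∈ Superstructure M.S)
    (hc : c ∈ Superstructure M.S) (h : ∀ x ∈ a, x ∈ b → x ∈ c) (hxa : x ∈ M.nse a)
    (hxb : x ∈ M.nse b) : x ∈ M.nse c := by
  have := transfer_list (M := M) (.ball 3 0 (.disj (.neg (.mem 3 1)) (.mem 3 2))) [a, b, c]
    (by simp [ha.1, hb, hc])
    (by
      simp only [BddFormula.Sat]
      intro x _ hx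
      simpa [imp_iff_not_or] using h x hx)
  have := this x (mem_superstructure_of_mem_nse ha hxa) hxa
  simp [BddFormula.Sat] at this
  tauto

theorem nse_subset_union (ha : M.IsStdSet a) (hb : b ∈ Superstructure M.S)
    (hc : c ∈ Superstructure M.S) (h : ∀ x ∈ a, x ∈ b ∨ x ∈ c) (hxa : x ∈ M.nse a) :
    x ∈ M.nse b ∨ x ∈ M.nse c := by
  have := transfer_list (M := M) (.ball 3 0 (.disj (.mem 3 1) (.mem 3 2))) [a, b, c]
    (by simp [ha.1, hb, hc])
    (by
      simp only [BddFormula.Sat]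
      intro x _ hx
      simpa using h x hx)
  have := this x (mem_superstructure_of_mem_nse ha hxa) hxa
  simpa [BddFormula.Sat] using this

theorem nse_disjoint (ha : M.IsStdSet a) (hb : b ∈ Superstructure M.S)
    (h : ∀ x ∈ a, x ∉ b) (hxa : x ∈ M.nse a) : x ∉ M.nse b := by
  have := transfer_list (M := M) (.ball 3 0 (.neg (.mem 3 1))) [a, b]
    (by simp [ha.1, hb])
    (by
      simp only [BddFormula.Sat]
      intro x _ hx
      simpa using h x hx)
  have := this x (mem_superstructure_of_mem_nse ha hxa) hxa
  simpa [BddFormula.Sat] using this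

end Sets

variable {X : ZFSet.{u}}

theorem setCode_injective : Function.Injective (setCode (X := X)) := by
  intro A B h
  ext x
  have := ZFSet.ext_iff.1 h x.1
  simpa [setCode, x.2] using this

theorem funCode_injective : Function.Injective (M.funCode (X := X)) := by
  intro f g h
  ext x
  have : ZFSet.pair x.1 (M.real (f x)) ∈ M.funCode g := h ▸ ZFSet.mem_range_self x
  obtain ⟨y, hy⟩ := ZFSet.mem_range.1 this
  obtain ⟨h1, h2⟩ := ZFSet.pair_inj.1 hy
  rw [Subtype.ext h1] at h2
  exact (M.real_injective h2).symm

theorem setCode_mem_superLevel {n : ℕ} (hn : X ⊆ superLevel M.S n) (A : Set X.El) :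
    setCode A ∈ superLevel M.S (n + 1) :=
  mem_superLevel_succ fun _ hx => hn (ZFSet.mem_sep.1 hx).1

theorem funCode_mem_superLevel {n : ℕ} (hn : X ⊆ superLevel M.S n) (f : X.El → ℝ) :
    M.funCode f ∈ superLevel M.S (n + 3) := by
  refine mem_superLevel_succ fun x hx => ?_
  obtain ⟨x, rfl⟩ := ZFSet.mem_range.1 hx
  exact pair_mem_superLevel (hn x.2) (real_mem_superLevel n _)

theorem pair_mem_closeRel {ε s t : ℝ} :
    ZFSet.pair (M.real s) (M.real t) ∈ M.closeRel ε ↔ |s - t| < ε := by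
  simp only [closeRel, ZFSet.mem_range, Subtype.exists, Prod.exists, ZFSet.pair_inj,
    M.real_injective.eq_iff]
  exact ⟨by rintro ⟨_, _, h, rfl, rfl⟩; exact h, fun h => ⟨_, _, h, rfl, rfl⟩⟩

variable [MeasurableSpace X.El]

theorem pair_mem_chargeCode {P : MSet X.El → ℝ} {A : MSet X.El} {b : ZFSet.{u}} :
    ZFSet.pair (setCode A.1) b ∈ M.chargeCode P ↔ b = M.real (P A) := by
  simp only [chargeCode, ZFSet.mem_range, ZFSet.pair_inj, setCode_injective.eq_iff]
  constructor
  · rintro ⟨B, h, rfl⟩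
    rw [Subtype.ext h]
  · rintro rfl
    exact ⟨A, rfl, rfl⟩

theorem chargeCode_injective : Function.Injective (M.chargeCode (X := X)) := by
  intro P Q h
  ext A
  have : ZFSet.pair (setCode A.1) (M.real (P A)) ∈ M.chargeCode Q :=
    h ▸ pair_mem_chargeCode.2 rfl
  exact M.real_injective (pair_mem_chargeCode.1 this)

theorem pair_mem_integralCode {f : X.El → ℝ} (hf : Measurable f) (hb : ∃ C, ∀ x, |f x| ≤ C)
    {P : MSet X.El → ℝ} (hP : IsCharge P) {b : ZFSet.{u}} :
    ZFSet.pair (ZFSet.pair (M.funCode f) (M.chargeCode P)) b ∈ M.integralCode X ↔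
      b = M.real (chargeIntegral P f) := by
  simp only [integralCode, ZFSet.mem_range, ZFSet.pair_inj, funCode_injective.eq_iff,
    chargeCode_injective.eq_iff]
  constructor
  · rintro ⟨_, ⟨rfl, rfl⟩, rfl⟩
    rfl
  · rintro rfl
    exact ⟨⟨⟨f, hf, hb⟩, ⟨P, hP⟩⟩, ⟨rfl, rfl⟩, rfl⟩

variable (M) in
/-- A set of charges as an element of the superstructure. -/
noncomputable def chargeSetCode (E : Set {P : MSet X.El → ℝ // IsCharge P}) : ZFSet.{u} :=
  ZFSet.range fun P : E => M.chargeCode P.1.1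

theorem chargeCode_mem_chargeSetCode {E : Set {P : MSet X.El → ℝ // IsCharge P}}
    {P : {P : MSet X.El → ℝ // IsCharge P}} :
    M.chargeCode P.1 ∈ M.chargeSetCode E ↔ P ∈ E := by
  simp only [chargeSetCode, ZFSet.mem_range, chargeCode_injective.eq_iff]
  exact ⟨by rintro ⟨Q, h⟩; exact Subtype.ext h ▸ Q.2, fun h => ⟨⟨P, h⟩, rfl⟩⟩

theorem forall_mem_chargeSetCode {E : Set {P : MSet X.El → ℝ // IsCharge P}}
    {p : ZFSet.{u} → Prop} :
    (∀ x ∈ M.chargeSetCode E, p x) ↔ ∀ P ∈ E, p (M.chargeCode P.1) := by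
  simp only [chargeSetCode, ZFSet.mem_range]
  exact ⟨fun h P hP => h _ ⟨⟨P, hP⟩, rfl⟩, by rintro h _ ⟨P, rfl⟩; exact h P.1 P.2⟩

variable (M X) in
theorem charges_eq : M.charges X = M.chargeSetCode (X := X) Set.univ := by
  ext x
  simp [charges, chargeSetCode]

/-! ### The codes lie in the superstructure -/

theorem closeRel_isStdSet (ε : ℝ) : M.IsStdSet (M.closeRel ε) := by
  refine isStdSet_of_subset (n := 2) fun x hx => ?_
  obtain ⟨p, rfl⟩ := ZFSet.mem_range.1 hx
  exact pair_mem_superLevel (real_mem_superLevel 0 _) (real_mem_superLevel 0 _)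

section Levels

variable {n : ℕ}

theorem chargeCode_mem_superLevel (hn : X ⊆ superLevel M.S n) (P : MSet X.El → ℝ) :
    M.chargeCode P ∈ superLevel M.S (n + 4) := by
  refine mem_superLevel_succ fun x hx => ?_
  obtain ⟨A, rfl⟩ := ZFSet.mem_range.1 hx
  exact pair_mem_superLevel (setCode_mem_superLevel hn _) (real_mem_superLevel _ _)

theorem chargeCode_isStdSet (hn : X ⊆ superLevel M.S n) (P : MSet X.El → ℝ) :
    M.IsStdSet (M.chargeCode P) := by
  refine isStdSet_of_subset (n := n + 3) fun x hx => ?_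
  obtain ⟨A, rfl⟩ := ZFSet.mem_range.1 hx
  exact pair_mem_superLevel (setCode_mem_superLevel hn _) (real_mem_superLevel _ _)

theorem chargeSetCode_isStdSet (hn : X ⊆ superLevel M.S n)
    (E : Set {P : MSet X.El → ℝ // IsCharge P}) : M.IsStdSet (M.chargeSetCode E) := by
  refine isStdSet_of_subset (n := n + 4) fun x hx => ?_
  obtain ⟨P, rfl⟩ := ZFSet.mem_range.1 hx
  exact chargeCode_mem_superLevel hn _

theorem integralCode_isStdSet (hn : X ⊆ superLevel M.S n) : M.IsStdSet (M.integralCode X) := by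
  refine isStdSet_of_subset (n := n + 8) fun x hx => ?_
  obtain ⟨q, rfl⟩ := ZFSet.mem_range.1 hx
  exact pair_mem_superLevel (pair_mem_superLevel
    (superLevel_mono M.S (by omega) (funCode_mem_superLevel hn _))
    (superLevel_mono M.S (by omega) (chargeCode_mem_superLevel hn _))) (real_mem_superLevel _ _)

/-! ## The ultrafilter of an internal probability measure -/

/-- An internal charge generates an ultrafilter on the set of standard charges. -/
noncomputable def internalUltrafilter (hn : X ⊆ superLevel M.S n) {ν : ZFSet.{u}}
    (hν : M.IsInternalProbability X ν) : Ultrafilter {P : MSet X.El → ℝ // IsCharge P} :=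
  have hE := chargeSetCode_isStdSet (M := M) hn
  Ultrafilter.ofComplNotMemIff
    { sets := {E | ν ∈ M.nse (M.chargeSetCode E)}
      univ_sets := by
        change ν ∈ M.nse (M.chargeSetCode Set.univ)
        exact charges_eq M X ▸ hν
      sets_of_superset := fun {E F} h hEF => nse_inter_subset (hE E) (hE E).1 (hE F).1
        (forall_mem_chargeSetCode.2 fun P hP _ => chargeCode_mem_chargeSetCode.2 (hEF hP)) h h
      inter_sets := fun {E F} h1 h2 => nse_inter_subset (hE E) (hE F).1 (hE _).1
        (forall_mem_chargeSetCode.2 fun P hP hP' =>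
          chargeCode_mem_chargeSetCode.2 ⟨hP, chargeCode_mem_chargeSetCode.1 hP'⟩) h1 h2 }
    -- `E` and its complement cover all charges and are disjoint; by transfer `ν` lies in exactly
    -- one of their extensions.
    fun E => by
      change ¬ ν ∈ M.nse (M.chargeSetCode Eᶜ) ↔ ν ∈ M.nse (M.chargeSetCode E)
      constructor
      · refine fun h => (nse_subset_union (hE Set.univ) (hE E).1 (hE Eᶜ).1
          (forall_mem_chargeSetCode.2 fun P _ => ?_) (charges_eq M X ▸ hν)).resolve_right h
        rw [chargeCode_mem_chargeSetCode, chargeCode_mem_chargeSetCode]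
        exact em _
      · refine nse_disjoint (hE E) (hE _).1 (forall_mem_chargeSetCode.2 fun P hP h => ?_)
        exact chargeCode_mem_chargeSetCode.1 h hP

theorem mem_internalUltrafilter (hn : X ⊆ superLevel M.S n) {ν : ZFSet.{u}}
    (hν : M.IsInternalProbability X ν) {E : Set {P : MSet X.El → ℝ // IsCharge P}} :
    E ∈ internalUltrafilter hn hν ↔ ν ∈ M.nse (M.chargeSetCode E) :=
  Iff.rfl

end Levels

end NonstandardExtension

namespace NonstandardExtension

variable {M : NonstandardExtension.{u}} {X : ZFSet.{u}} [MeasurableSpace X.El] {n : ℕ}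

/-! ## Transfer of the evaluation of charges and integrals -/

/-- Variable `2` holds a set of charges, `3` a relation, `4` a real: the charge `10` belongs to
the set if and only if its value `13` is related to the real. -/
def memIffRelated : BddFormula :=
  .disj (.conj (.mem 10 2) (.bex 20 3 (.isPair 20 13 4)))
    (.conj (.neg (.mem 10 2)) (.neg (.bex 20 3 (.isPair 20 13 4))))

theorem sat_memIffRelated {S : ZFSet.{u}} (hS : IsBaseSet S) {v : ℕ → ZFSet.{u}}
    (h3 : v 3 ∈ Superstructure S) (h3' : v 3 ∉ S) (h4 : v 4 ∈ Superstructure S)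
    (h13 : v 13 ∈ Superstructure S) :
    memIffRelated.Sat (Superstructure S) v ↔
      (v 10 ∈ v 2 ↔ ZFSet.pair (v 13) (v 4) ∈ v 3) := by
  rw [← exists_isPairIn_iff hS h3 h3' h13 h4]
  simp only [memIffRelated, BddFormula.Sat, BddFormula.sat_isPair _ (by norm_num : 20 < 100)
    (by norm_num : 13 < 100) (by norm_num : 4 < 100)]
  simp [iff_iff_and_or_not_and_not]

theorem real_mem_superstructure (t : ℝ) : M.real t ∈ Superstructure M.S := ⟨0, M.real_mem t⟩

theorem exists_pair_mem_internal (hn : X ⊆ superLevel M.S n) {ν : ZFSet.{u}}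
    (hν : M.IsInternalProbability X ν) (A : MSet X.El) :
    ∃ b, ZFSet.pair (M.nse (setCode A.1)) b ∈ ν := by
  have hC : M.IsStdSet (M.charges X) := charges_eq M X ▸ chargeSetCode_isStdSet hn _
  have hA : setCode A.1 ∈ Superstructure M.S := ⟨_, setCode_mem_superLevel hn A.1⟩
  have := transfer_list (M := M)
    -- With bounded quantifiers the value `b` is reached by descending from the charge through the
    -- pair and then `{a, b}`.
    (.ball 10 0 (.bex 11 10 (.bex 12 11 (.bex 13 12 (.isPair 11 1 13)))))
    [M.charges X, setCode A.1] (by simp [hC.1, hA])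
    (by
      simp only [BddFormula.Sat, BddFormula.sat_isPair _ (by norm_num : 11 < 100)
        (by norm_num : 1 < 100) (by norm_num : 13 < 100)]
      intro x hx hxC
      simp at hxC ⊢
      rw [charges_eq] at hxC
      obtain ⟨P, rfl⟩ := ZFSet.mem_range.1 hxC
      have hp : ZFSet.pair (setCode A.1) (M.real (P.1.1 A)) ∈ M.chargeCode P.1.1 :=
        pair_mem_chargeCode.2 rfl
      have hpU := Superstructure.of_mem hx (chargeCode_isStdSet hn _).2 hp
      exact ⟨_, hpU, hp, _, upair_mem_of_pair_mem M.isBaseSet hpU hA, upair_mem_pair _ _, _,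
        real_mem_superstructure _, by simp,
        (isPairIn_iff M.isBaseSet hpU hA (real_mem_superstructure _)).2 rfl⟩)
  simp only [BddFormula.Sat, BddFormula.sat_isPair _ (by norm_num : 11 < 100)
        (by norm_num : 1 < 100) (by norm_num : 13 < 100)] at this
  obtain ⟨p, hp, hpν, c, -, -, b, hb, -, h⟩ := this ν (mem_superstructure_of_mem_nse hC hν) hν
  simp at hpν h
  rw [isPairIn_iff M.isBaseSet_nse hp (M.nse_mem _ hA) hb] at h
  exact ⟨b, h ▸ hpν⟩

theorem exists_pair_mem_nse_integralCode (hn : X ⊆ superLevel M.S n) {ν : ZFSet.{u}}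
    (hν : M.IsInternalProbability X ν) {f : X.El → ℝ} (hf : Measurable f)
    (hfb : ∃ C, ∀ x, |f x| ≤ C) :
    ∃ b, ZFSet.pair (ZFSet.pair (M.nse (M.funCode f)) ν) b ∈ M.nse (M.integralCode X) := by
  have hC : M.IsStdSet (M.charges X) := charges_eq M X ▸ chargeSetCode_isStdSet hn _
  have hI : M.IsStdSet (M.integralCode X) := integralCode_isStdSet hn
  have hF : M.funCode f ∈ Superstructure M.S := ⟨_, funCode_mem_superLevel hn f⟩
  have := transfer_list (M := M)
    -- The descent is made twice from a pair `(z, b)` with `z = (f, P)`: through `{z}` to `z`, and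
    -- through `{z, b}` to `b`.
    (.ball 10 5 (.bex 11 0 (.bex 12 11 (.bex 14 12 (.bex 15 11 (.bex 13 15
      (.conj (.isPair 14 1 10) (.isPair 11 14 13))))))))
    -- The copies of `M.S` are placeholders that put the set of charges in variable `5`.
    [M.integralCode X, M.funCode f, M.S, M.S, M.S, M.charges X]
    (by simp [hC.1, hI.1, hF]; exact ⟨1, mem_superLevel_succ fun _ h => h⟩)
    (by
      simp only [BddFormula.Sat, BddFormula.sat_isPair _ (by norm_num : 14 < 100)
        (by norm_num : 1 < 100) (by norm_num : 10 < 100),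
        BddFormula.sat_isPair _ (by norm_num : 11 < 100)
        (by norm_num : 14 < 100) (by norm_num : 13 < 100)]
      intro x hx hxC
      simp at hxC ⊢
      rw [charges_eq] at hxC
      obtain ⟨P, rfl⟩ := ZFSet.mem_range.1 hxC
      have hp := (pair_mem_integralCode (M := M) hf hfb P.1.2).2 rfl
      have hpU := Superstructure.of_mem hI.1 hI.2 hp
      have hzU : ZFSet.pair (M.funCode f) (M.chargeCode P.1.1) ∈ Superstructure M.S :=
        ⟨_, pair_mem_superLevel (superLevel_mono M.S (by omega) (funCode_mem_superLevel hn f))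
          (chargeCode_mem_superLevel hn P.1.1)⟩
      have hb := real_mem_superstructure (M := M) (chargeIntegral P.1.1 f)
      exact ⟨_, hpU, hp, _, singleton_mem_superstructure hzU, singleton_mem_pair _ _,
        _, hzU, by simp, _, upair_mem_of_pair_mem M.isBaseSet hpU hzU, upair_mem_pair _ _, _, hb,
        by simp, (isPairIn_iff M.isBaseSet hzU hF hx).2 rfl,
        (isPairIn_iff M.isBaseSet hpU hzU hb).2 rfl⟩)
  simp only [BddFormula.Sat, BddFormula.sat_isPair _ (by norm_num : 14 < 100)
        (by norm_num : 1 < 100) (by norm_num : 10 < 100),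
        BddFormula.sat_isPair _ (by norm_num : 11 < 100)
        (by norm_num : 14 < 100) (by norm_num : 13 < 100)] at this
  have hνU := mem_superstructure_of_mem_nse hC hν
  obtain ⟨p, hp, hpI, c, -, -, z, hz, -, d, -, -, b, hb, -, h1, h2⟩ := this ν hνU hν
  simp at hpI h1 h2
  rw [isPairIn_iff M.isBaseSet_nse hp hz hb] at h2
  rw [isPairIn_iff M.isBaseSet_nse hz (M.nse_mem _ hF) hνU] at h1
  exact ⟨b, h1 ▸ h2 ▸ hpI⟩

/-- An instance of Łoś's theorem, got by transferring an equivalence true of every standard charge.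
It holds for any `b` paired with `*A` in `ν`, so `ν` need not be shown to be single-valued. -/
theorem pair_mem_nse_closeRel_iff (hn : X ⊆ superLevel M.S n) {ν : ZFSet.{u}}
    (hν : M.IsInternalProbability X ν) (A : MSet X.El) {b : ZFSet.{u}}
    (hb : ZFSet.pair (M.nse (setCode A.1)) b ∈ ν) (t ε : ℝ) :
    ZFSet.pair b (M.real t) ∈ M.nse (M.closeRel ε) ↔
      {P | |P.1 A - t| < ε} ∈ internalUltrafilter hn hν := by
  have hC : M.IsStdSet (M.charges X) := charges_eq M X ▸ chargeSetCode_isStdSet hn _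
  have hA : setCode A.1 ∈ Superstructure M.S := ⟨_, setCode_mem_superLevel hn A.1⟩
  have hR := closeRel_isStdSet (M := M) ε
  have ht := real_mem_superstructure (M := M) t
  have := transfer_list (M := M)
    (.ball 10 0 (.ball 11 10 (.ball 12 11 (.ball 13 12
      (.disj (.neg (.isPair 11 1 13)) memIffRelated)))))
    [M.charges X, setCode A.1, M.chargeSetCode {P | |P.1 A - t| < ε}, M.closeRel ε, M.real t]
    (by simp [hC.1, hA, (chargeSetCode_isStdSet hn _).1, hR.1, ht])
    (by
      simp only [BddFormula.Sat, BddFormula.sat_isPair _ (by norm_num : 11 < 100)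
        (by norm_num : 1 < 100) (by norm_num : 13 < 100)]
      intro x hx hxC p hp hpx c _ _ b hb _
      rw [sat_memIffRelated M.isBaseSet (by simp [hR.1]) (by simp [hR.2]) (by simp [ht])
        (by simp [hb]), ← imp_iff_not_or]
      simp at hxC hpx ⊢
      rw [isPairIn_iff M.isBaseSet hp hA hb]
      rintro rfl
      rw [charges_eq] at hxC
      obtain ⟨P, rfl⟩ := ZFSet.mem_range.1 hxC
      rw [pair_mem_chargeCode.1 hpx, pair_mem_closeRel]
      exact chargeCode_mem_chargeSetCode)
  have hνC : ν ∈ M.nse (M.charges X) := hν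
  have hνU := mem_superstructure_of_mem_nse hC hνC
  have hA' := M.nse_mem _ hA
  -- No charge is an individual, so by transfer neither is `ν`; hence its elements lie in the
  -- superstructure.
  have hνS : ν ∉ M.nse M.S := nse_disjoint hC ⟨1, mem_superLevel_succ fun _ h => h⟩
    (by
      rw [charges_eq]
      exact forall_mem_chargeSetCode.2 fun P _ => (chargeCode_isStdSet hn _).2) hν
  have hpU := Superstructure.of_mem hνU hνS hb
  have hbU := mem_of_pair_mem M.isBaseSet_nse hpU hA'
  have := this ν hνU hν _ hpU (by simpa using hb) _
    (upair_mem_of_pair_mem M.isBaseSet_nse hpU hA') (by simp [upair_mem_pair]) b hbU (by simp)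
  simp only [BddFormula.Sat, BddFormula.sat_isPair _ (by norm_num : 11 < 100)
    (by norm_num : 1 < 100) (by norm_num : 13 < 100)] at this
  rw [sat_memIffRelated M.isBaseSet_nse (by simpa using M.nse_mem _ hR.1)
    (by simpa using nse_notMem hR) (by simpa using M.nse_mem _ ht) (by simpa using hbU),
    ← imp_iff_not_or] at this
  simp at this
  rw [mem_internalUltrafilter, ← nse_real]
  exact (this ((isPairIn_iff M.isBaseSet_nse hpU hA' hbU).2 rfl)).symm

/-- The same transfer for the integral map in place of evaluation at `A`, with the same ultrafilter;
this links the integral to the push-down. -/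
theorem pair_mem_nse_closeRel_iff_integral (hn : X ⊆ superLevel M.S n) {ν : ZFSet.{u}}
    (hν : M.IsInternalProbability X ν) {f : X.El → ℝ} (hf : Measurable f)
    (hfb : ∃ C, ∀ x, |f x| ≤ C) {b : ZFSet.{u}}
    (hb : ZFSet.pair (ZFSet.pair (M.nse (M.funCode f)) ν) b ∈ M.nse (M.integralCode X))
    (t ε : ℝ) :
    ZFSet.pair b (M.real t) ∈ M.nse (M.closeRel ε) ↔
      {P | |chargeIntegral P.1 f - t| < ε} ∈ internalUltrafilter hn hν := by
  have hC : M.IsStdSet (M.charges X) := charges_eq M X ▸ chargeSetCode_isStdSet hn _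
  have hI : M.IsStdSet (M.integralCode X) := integralCode_isStdSet hn
  have hF : M.funCode f ∈ Superstructure M.S := ⟨_, funCode_mem_superLevel hn f⟩
  have hR := closeRel_isStdSet (M := M) ε
  have ht := real_mem_superstructure (M := M) t
  have := transfer_list (M := M)
    (.ball 10 5 (.ball 11 0 (.ball 12 11 (.ball 14 12 (.ball 15 11 (.ball 13 15
      (.disj (.neg (.conj (.isPair 14 1 10) (.isPair 11 14 13))) memIffRelated)))))))
    [M.integralCode X, M.funCode f, M.chargeSetCode {P | |chargeIntegral P.1 f - t| < ε},
      M.closeRel ε, M.real t, M.charges X]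
    (by simp [hC.1, hI.1, hF, (chargeSetCode_isStdSet hn _).1, hR.1, ht])
    (by
      simp only [BddFormula.Sat, BddFormula.sat_isPair _ (by norm_num : 14 < 100)
        (by norm_num : 1 < 100) (by norm_num : 10 < 100),
        BddFormula.sat_isPair _ (by norm_num : 11 < 100)
        (by norm_num : 14 < 100) (by norm_num : 13 < 100)]
      intro x hx hxC p hp hpI c _ _ z hz _ d _ _ b hb _
      rw [sat_memIffRelated M.isBaseSet (by simp [hR.1]) (by simp [hR.2]) (by simp [ht])
        (by simp [hb]), ← imp_iff_not_or]
      simp at hxC hpI ⊢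
      rw [isPairIn_iff M.isBaseSet hp hz hb, isPairIn_iff M.isBaseSet hz hF hx]
      rintro rfl rfl
      rw [charges_eq] at hxC
      obtain ⟨P, rfl⟩ := ZFSet.mem_range.1 hxC
      rw [(pair_mem_integralCode hf hfb P.1.2).1 hpI, pair_mem_closeRel]
      exact chargeCode_mem_chargeSetCode)
  have hνU := mem_superstructure_of_mem_nse hC hν
  have hF' := M.nse_mem _ hF
  have hpU := mem_superstructure_of_mem_nse hI hb
  have hzU : ZFSet.pair (M.nse (M.funCode f)) ν ∈ Superstructure (M.nse M.S) := by
    obtain ⟨k, hk⟩ := hF'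
    obtain ⟨m, hm⟩ := hνU
    exact ⟨_, pair_mem_superLevel (superLevel_mono _ (le_max_left k m) hk)
      (superLevel_mono _ (le_max_right k m) hm)⟩
  have hbU := mem_of_pair_mem M.isBaseSet_nse hpU hzU
  have := this ν hνU hν _ hpU (by simpa using hb) _ (singleton_mem_superstructure hzU)
    (by simp [singleton_mem_pair]) _ hzU (by simp) _
    (upair_mem_of_pair_mem M.isBaseSet_nse hpU hzU) (by simp [upair_mem_pair]) b hbU (by simp)
  simp only [BddFormula.Sat, BddFormula.sat_isPair _ (by norm_num : 14 < 100)
        (by norm_num : 1 < 100) (by norm_num : 10 < 100),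
        BddFormula.sat_isPair _ (by norm_num : 11 < 100)
        (by norm_num : 14 < 100) (by norm_num : 13 < 100)] at this
  rw [sat_memIffRelated M.isBaseSet_nse (by simpa using M.nse_mem _ hR.1)
    (by simpa using nse_notMem hR) (by simpa using M.nse_mem _ ht) (by simpa using hbU),
    ← imp_iff_not_or] at this
  simp at this
  rw [mem_internalUltrafilter, ← nse_real]
  exact (this ((isPairIn_iff M.isBaseSet_nse hzU hF' hνU).2 rfl)
    ((isPairIn_iff M.isBaseSet_nse hpU hzU hbU).2 rfl)).symm

/-! ### Standard parts as limits along the ultrafilter -/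

theorem pair_app_mem {F a : ZFSet.{u}} (h : ∃ b, ZFSet.pair a b ∈ F) :
    ZFSet.pair a (F.app a) ∈ F := by
  rw [ZFSet.app, dif_pos h]
  exact h.choose_spec

theorem near_app_iff (hn : X ⊆ superLevel M.S n) {ν : ZFSet.{u}}
    (hν : M.IsInternalProbability X ν) (A : MSet X.El) (t : ℝ) :
    M.Near (ν.app (M.nse (setCode A.1))) (M.real t) ↔
      Tendsto (fun P : {P : MSet X.El → ℝ // IsCharge P} => P.1 A)
        (internalUltrafilter hn hν) (𝓝 t) := by
  simp only [Near, Metric.tendsto_nhds, Real.dist_eq, pair_mem_nse_closeRel_iff hn hν A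
    (pair_app_mem (exists_pair_mem_internal hn hν A))]
  rfl

theorem near_internalIntegral_iff (hn : X ⊆ superLevel M.S n) {ν : ZFSet.{u}}
    (hν : M.IsInternalProbability X ν) {f : X.El → ℝ} (hf : Measurable f)
    (hfb : ∃ C, ∀ x, |f x| ≤ C) (t : ℝ) :
    M.Near (M.internalIntegral X (M.nse (M.funCode f)) ν) (M.real t) ↔
      Tendsto (fun P : {P : MSet X.El → ℝ // IsCharge P} => chargeIntegral P.1 f)
        (internalUltrafilter hn hν) (𝓝 t) := by
  simp only [Near, Metric.tendsto_nhds, Real.dist_eq, internalIntegral,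
    pair_mem_nse_closeRel_iff_integral hn hν hf hfb
      (pair_app_mem (exists_pair_mem_nse_integralCode hn hν hf hfb))]
  rfl

/-- The internal push-down is the setwise limit of the standard charges along the ultrafilter. -/
theorem tendsto_pushDown (hn : X ⊆ superLevel M.S n) {ν : ZFSet.{u}}
    (hν : M.IsInternalProbability X ν) (A : MSet X.El) :
    Tendsto (fun P : {P : MSet X.El → ℝ // IsCharge P} => P.1 A)
        (internalUltrafilter hn hν) (𝓝 (M.pushDown ν A)) := by
  -- Compactness only rules out the default value of `st`; the real chosen by `st` is then a limit
  -- by its defining property.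
  obtain ⟨t, -, ht⟩ := (isCompact_Icc (a := (0 : ℝ)) (b := 1)).ultrafilter_le_nhds
    ((internalUltrafilter hn hν).map fun P : {P : MSet X.El → ℝ // IsCharge P} => P.1 A)
    (le_principal_iff.2 (Filter.mem_map.2 (Filter.univ_mem' fun P => P.2.mem_Icc A)))
  have h : ∃ t, M.Near (ν.app (M.nse (setCode A.1))) (M.real t) :=
    ⟨t, (near_app_iff hn hν A t).2 ht⟩
  rw [← near_app_iff hn hν A, pushDown, st, dif_pos h]
  exact h.choose_spec

end NonstandardExtension

theorem mainTheorem9 (M : NonstandardExtension.{u}) (X : ZFSet.{u})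
    (hX : X ∈ Superstructure M.S) (hXset : X ∉ M.S)
    [MetricSpace X.El] [MeasurableSpace X.El] [BorelSpace X.El]
    (ν : ZFSet.{u}) (hν : M.IsInternalProbability X ν)
    (f : X.El → ℝ) (hf : Measurable f) (hfb : ∃ C, ∀ x, |f x| ≤ C) :
    IsCharge (M.pushDown (X := X) ν) ∧
    ChargeIntegrable (M.pushDown ν) f ∧
    M.Near (M.internalIntegral X (M.nse (M.funCode f)) ν)
      (M.real (chargeIntegral (M.pushDown ν) f)) := by
  obtain ⟨n, hn⟩ := exists_subset_superLevel hX hXset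
  have hlim := NonstandardExtension.tendsto_pushDown hn hν
  have hP : IsCharge (M.pushDown (X := X) ν) := .of_tendsto (fun P => P.2) hlim
  exact ⟨hP, hP.chargeIntegrable hf hfb,
    (NonstandardExtension.near_internalIntegral_iff hn hν hf hfb _).2
      (tendsto_chargeIntegral (fun P => P.2) hP hlim hf hfb)⟩
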